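/- Let $n \ge 2$ be an integer, let $0 < a < 1$, and let $\mathbb{R}^n_+ = \{x = (x', x_n) \in \mathbb{R}^n : x_n > 0\}$. Suppose that $u \in C^2(\mathbb{R}^n_+) \cap C^1(\overline{\mathbb{R}^n_+})$ satisfies $$\operatorname{div}(x_n^a \nabla u) = 0 \quad\text{and}\quad u > 0 \quad \text{in } \mathbb{R}^n_+.$$ Then there is a constant $C > 0$ such that $u = C$ on $\overline{\mathbb{R}^n_+}$. -/

import Mathlib

/-- The index of the last coordinate `x_n` of `ℝⁿ`, for `n ≠ 0`. -/
def lastIdx (n : ℕ) [NeZero n] : Fin n :=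
  ⟨n - 1, Nat.sub_one_lt (NeZero.ne n)⟩

/-- The open upper half space `ℝⁿ₊ = {x ∈ ℝⁿ : x_n > 0}`. -/
def upperHalfSpace (n : ℕ) [NeZero n] : Set (EuclideanSpace ℝ (Fin n)) :=
  {x | 0 < x (lastIdx n)}

/-- The divergence `∑ᵢ ∂ᵢ Fᵢ` of a vector field `F` on `ℝⁿ`. -/
noncomputable def divergence {n : ℕ}
    (F : EuclideanSpace ℝ (Fin n) → EuclideanSpace ℝ (Fin n))
    (x : EuclideanSpace ℝ (Fin n)) : ℝ :=
  ∑ i : Fin n, fderiv ℝ (fun y => F y i) x (EuclideanSpace.single i 1)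

/-- The operator `u ↦ div (x_nᵃ ∇u)`. It is applied only to functions of class `C²` near points
of the open upper half space, where the field `x_nᵃ ∇u` is differentiable. -/
noncomputable def weightedLaplacian {n : ℕ} [NeZero n] (a : ℝ)
    (u : EuclideanSpace ℝ (Fin n) → ℝ) (x : EuclideanSpace ℝ (Fin n)) : ℝ :=
  divergence (fun y => (y (lastIdx n)) ^ a • gradient u y) x

open MeasureTheory Set Filter Topology

/-! Since `∇u` is continuous up to the boundary and `a > 0`, the flux `x_n ^ a ∇u` vanishes on the
boundary hyperplane, so the divergence theorem on the half space has no term there. The weight is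
invariant under tangential translation and homogeneous under dilation. Testing against radial
functions about a boundary point `x₀` therefore shows that `u x₀` is the weighted radial average of
`u` about `x₀` (`integral_sub_mul_radial_eq_zero`).

Nonnegativity is then used twice. Averages over large balls about two boundary points are
comparable, with mass ratio tending to 1, so `u` equals a constant `c` on the boundary
(`le_of_boundary`). Monotone limits give the mean value property for Gaussians of every width
(`lintegral_mul_gaussian`).

So the densities `x_n ^ a u exp (-|x|²)` and `x_n ^ a c exp (-|x|²)` have the same integrals against
all Gaussians centred on the boundary. These span an algebra which separates points of the closed
half space, hence determines finite measures (`gaussianMeasure_eq_const`). Thus `u = c` almost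
everywhere, and everywhere by continuity. -/

/-! ### Divergence theorem on half cubes against radial fields -/

/-- The squared Euclidean length of `z`. -/
def sqLength {ι : Type*} [Fintype ι] (z : ι → ℝ) : ℝ := ∑ i, z i ^ 2

lemma sqLength_nonneg {ι : Type*} [Fintype ι] (z : ι → ℝ) : 0 ≤ sqLength z :=
  Finset.sum_nonneg fun i _ => sq_nonneg (z i)

lemma sq_le_sqLength {ι : Type*} [Fintype ι] (z : ι → ℝ) (i : ι) : z i ^ 2 ≤ sqLength z :=
  Finset.single_le_sum (f := fun i => z i ^ 2) (fun i _ => sq_nonneg (z i)) (Finset.mem_univ i)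

@[fun_prop]
lemma continuous_sqLength {ι : Type*} [Fintype ι] :
    Continuous (sqLength : (ι → ℝ) → ℝ) := by
  unfold sqLength; fun_prop

lemma hasFDerivAt_sqLength {ι : Type*} [Fintype ι] (z : ι → ℝ) :
    HasFDerivAt sqLength
      (∑ i, (2 * z i) • ContinuousLinearMap.proj (R := ℝ) (φ := fun _ : ι => ℝ) i) z := by
  unfold sqLength
  refine HasFDerivAt.fun_sum fun i _ => ?_
  have h := (ContinuousLinearMap.proj (R := ℝ) (φ := fun _ : ι => ℝ) i).hasFDerivAt (x := z)
  simpa using h.pow 2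

/-- The half cube `{z : |z i| ≤ M, 0 ≤ z l}`. -/
def halfCube {m : ℕ} (l : Fin (m + 1)) (M : ℝ) : Set (Fin (m + 1) → ℝ) :=
  Icc (Function.update (fun _ => -M) l 0) fun _ => M

lemma isCompact_halfCube {m : ℕ} (l : Fin (m + 1)) (M : ℝ) : IsCompact (halfCube l M) :=
  isCompact_Icc

lemma nonneg_of_mem_halfCube {m : ℕ} {l : Fin (m + 1)} {M : ℝ} {z : Fin (m + 1) → ℝ}
    (hz : z ∈ halfCube l M) : 0 ≤ z l := by
  simpa using hz.1 l

lemma mem_halfCube_of_sqLength_le {m : ℕ} {l : Fin (m + 1)} {M : ℝ} (hM : 0 ≤ M)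
    {z : Fin (m + 1) → ℝ} (hl : 0 ≤ z l) (hz : sqLength z ≤ M ^ 2) : z ∈ halfCube l M := by
  have h i : |z i| ≤ M := abs_le_of_sq_le_sq ((sq_le_sqLength z i).trans hz) hM
  refine ⟨fun i => ?_, fun i => (abs_le.1 (h i)).2⟩
  by_cases hi : i = l
  · subst hi; simpa using hl
  · simpa [hi] using (abs_le.1 (h i)).1

/-- A divergence-free field on a half space whose normal component vanishes on the boundary is
orthogonal to the radial fields `z ↦ g (|z|²) z` of bounded support. -/
lemma integral_field_mul_radial_eq_zero {m : ℕ} (l : Fin (m + 1))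
    {G : (Fin (m + 1) → ℝ) → Fin (m + 1) → ℝ}
    (hGc : ContinuousOn G {z | 0 ≤ z l})
    (hGd : ∀ z, 0 < z l → DifferentiableAt ℝ G z)
    (hdiv : ∀ z, 0 < z l → ∑ i, fderiv ℝ G z (Pi.single i 1) i = 0)
    (hG0 : ∀ z, z l = 0 → G z = 0)
    {g : ℝ → ℝ} (hg : Continuous g) {M : ℝ} (hM : 0 < M) (hgM : ∀ s, M ^ 2 ≤ s → g s = 0) :
    ∫ z in halfCube l M, ∑ i, G z i * (z i * g (sqLength z)) = 0 := by
  -- `φ (|z|²)` has gradient `g (|z|²) z`: the half cancels the 2 from `|z|²`. The base point `M ^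
  -- 2` makes `φ` vanish beyond the support of `g`.
  set φ : ℝ → ℝ := fun s => (∫ σ in (M ^ 2)..s, g σ) / 2 with hφ
  have hφd (s : ℝ) : HasDerivAt φ (g s / 2) s :=
    (intervalIntegral.integral_hasDerivAt_right (hg.intervalIntegrable _ _)
      (hg.stronglyMeasurableAtFilter _ _) hg.continuousAt).div_const 2
  have hφc : Continuous φ := continuous_iff_continuousAt.2 fun s => (hφd s).continuousAt
  have hφ0 (s : ℝ) (hs : M ^ 2 ≤ s) : φ s = 0 := by
    simp only [hφ]
    rw [intervalIntegral.integral_congr (g := fun _ => (0 : ℝ))]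
    · simp
    · intro σ hσ
      rw [uIcc_of_le hs] at hσ
      exact hgM σ hσ.1
  set Φ' : (Fin (m + 1) → ℝ) → (Fin (m + 1) → ℝ) →L[ℝ] ℝ := fun z =>
    (g (sqLength z) / 2) •
      ∑ i, (2 * z i) • ContinuousLinearMap.proj (R := ℝ) (φ := fun _ => ℝ) i with hΦ'
  have hΦd z : HasFDerivAt (fun z => φ (sqLength z)) (Φ' z) z :=
    (hφd (sqLength z)).comp_hasFDerivAt z (hasFDerivAt_sqLength z)
  have hΦs z (i : Fin (m + 1)) : Φ' z (Pi.single i 1) = z i * g (sqLength z) := by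
    simp only [hΦ', _root_.smul_apply, _root_.sum_apply,
      ContinuousLinearMap.proj_apply, smul_eq_mul]
    rw [Finset.sum_eq_single i]
    · simp; ring
    · intro b _ hb; simp [hb]
    · simp
  set lo : Fin (m + 1) → ℝ := Function.update (fun _ => -M) l 0 with hlo
  have hint : IntegrableOn (fun z => ∑ i, G z i * (z i * g (sqLength z))) (halfCube l M) := by
    refine ContinuousOn.integrableOn_compact (isCompact_halfCube l M) ?_
    refine continuousOn_finsetSum _ fun i _ => ContinuousOn.mul ?_ (by fun_prop)
    exact (continuousOn_pi.1 hGc i).mono fun z hz => nonneg_of_mem_halfCube hz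
  set F' : (Fin (m + 1) → ℝ) → (Fin (m + 1) → ℝ) →L[ℝ] (Fin (m + 1) → ℝ) := fun z =>
    φ (sqLength z) • fderiv ℝ G z + (Φ' z).smulRight (G z) with hF'
  have hpt z (hz : 0 < z l) :
      ∑ i, F' z (Pi.single i 1) i = ∑ i, G z i * (z i * g (sqLength z)) := by
    simp only [hF', _root_.add_apply, _root_.smul_apply,
      ContinuousLinearMap.smulRight_apply, Pi.add_apply, Pi.smul_apply, smul_eq_mul,
      Finset.sum_add_distrib, ← Finset.mul_sum, hdiv z hz, hΦs, mul_zero, zero_add]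
    exact Finset.sum_congr rfl fun i _ => mul_comm _ _
  have hae : ∀ᵐ z ∂(volume.restrict (halfCube l M)), 0 < z l := by
    have h1 : ∀ᵐ z : Fin (m + 1) → ℝ, z l ≠ 0 := by
      have h2 : ∀ᵐ y : ℝ, y ≠ 0 := by simp [ae_iff]
      exact (Measure.quasiMeasurePreserving_eval (fun _ : Fin (m + 1) => (volume : Measure ℝ))
        l).ae h2
    rw [ae_restrict_iff' (isCompact_halfCube l M).measurableSet]
    filter_upwards [h1] with z hz hz'
    exact lt_of_le_of_ne (nonneg_of_mem_halfCube hz') hz.symm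
  have hae' : (fun z => ∑ i, F' z (Pi.single i 1) i) =ᵐ[volume.restrict (halfCube l M)]
      fun z => ∑ i, G z i * (z i * g (sqLength z)) := by
    filter_upwards [hae] with z hz using hpt z hz
  rw [← integral_congr_ae hae']
  have key := integral_divergence_of_hasFDerivAt_off_countable lo (fun _ => M)
    (fun i => by
      by_cases hi : i = l
      · subst hi; simpa [hlo] using hM.le
      · simp [hlo, hi]; linarith)
    (fun z => φ (sqLength z) • G z) F' ∅ countable_empty
    ((hφc.comp continuous_sqLength).continuousOn.smul
      (hGc.mono fun z hz => nonneg_of_mem_halfCube hz))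
    (fun z hz => by
      have hzl : 0 < z l := by simpa [hlo] using (hz.1 l (mem_univ l)).1
      exact (hΦd z).smul (hGd z hzl).hasFDerivAt)
    (hint.congr hae'.symm)
  refine key.trans (Finset.sum_eq_zero fun i _ => ?_)
  -- On a face `|z i| = M` the cutoff vanishes because `|z|² ≥ M ^ 2`; on the flat face `z l = 0`
  -- the field itself vanishes.
  have hout (z : Fin (m + 1) → ℝ) (hz : |z i| = M) : φ (sqLength z) • G z = 0 := by
    rw [hφ0 _ (by rw [← hz, sq_abs]; exact sq_le_sqLength z i), zero_smul]
  have h1 (x : Fin m → ℝ) :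
      (φ (sqLength (i.insertNth M x : Fin (m + 1) → ℝ)) •
        G (i.insertNth M x : Fin (m + 1) → ℝ)) i = 0 := by
    rw [hout _ (by simp [abs_of_pos hM])]; rfl
  have h2 (x : Fin m → ℝ) :
      (φ (sqLength (i.insertNth (lo i) x : Fin (m + 1) → ℝ)) •
        G (i.insertNth (lo i) x : Fin (m + 1) → ℝ)) i = 0 := by
    by_cases hi : i = l
    · subst hi
      rw [hG0 _ (by simp [hlo])]; simp
    · rw [hout _ (by simp [hlo, hi, abs_of_pos hM])]; rfl
  simp only [h1, h2, integral_zero, sub_zero]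

/-! ### Weighted harmonic functions and their boundary mean values -/

/-- `U` is of class `C¹` on the closed half space `{0 ≤ z l}` with derivative `D`, and the field
`(z l) ^ a • ∇U` is differentiable and divergence-free in the open half space. -/
structure IsWeightedHarmonic {m : ℕ} (l : Fin (m + 1)) (a : ℝ) (U : (Fin (m + 1) → ℝ) → ℝ)
    (D : (Fin (m + 1) → ℝ) → (Fin (m + 1) → ℝ) →L[ℝ] ℝ) : Prop where
  hasFDerivWithinAt : ∀ z, 0 ≤ z l → HasFDerivWithinAt U (D z) {z | 0 ≤ z l} z
  continuousOn_deriv : ContinuousOn D {z | 0 ≤ z l}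
  differentiableAt_field : ∀ z, 0 < z l →
    DifferentiableAt ℝ (fun z i => z l ^ a * D z (Pi.single i 1)) z
  divergence_eq_zero : ∀ z, 0 < z l →
    ∑ i, fderiv ℝ (fun z i => z l ^ a * D z (Pi.single i 1)) z (Pi.single i 1) i = 0

lemma continuous_apply_rpow {m : ℕ} (l : Fin (m + 1)) {a : ℝ} (ha : 0 ≤ a) :
    Continuous fun z : Fin (m + 1) → ℝ => z l ^ a :=
  (continuous_apply l).rpow_const fun _ => Or.inr ha

namespace IsWeightedHarmonic

variable {m : ℕ} {l : Fin (m + 1)} {a : ℝ} {U : (Fin (m + 1) → ℝ) → ℝ}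
  {D : (Fin (m + 1) → ℝ) → (Fin (m + 1) → ℝ) →L[ℝ] ℝ}

lemma continuousOn (h : IsWeightedHarmonic l a U D) : ContinuousOn U {z | 0 ≤ z l} :=
  fun z hz => (h.hasFDerivWithinAt z hz).continuousWithinAt

lemma integral_radial_deriv_eq_zero (h : IsWeightedHarmonic l a U D) (ha : 0 < a)
    {x₀ : Fin (m + 1) → ℝ} (hx₀ : x₀ l = 0) {g : ℝ → ℝ} (hg : Continuous g) {M : ℝ} (hM : 0 < M)
    (hgM : ∀ s, M ^ 2 ≤ s → g s = 0) {t : ℝ} (ht : 0 < t) :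
    ∫ z in halfCube l M, z l ^ a * (D (x₀ + t • z) z * g (sqLength z)) = 0 := by
  set G : (Fin (m + 1) → ℝ) → Fin (m + 1) → ℝ := fun z i => z l ^ a * D z (Pi.single i 1) with hG
  have hl z : (x₀ + t • z) l = t * z l := by simp [hx₀]
  have hmap z : HasFDerivAt (fun z : Fin (m + 1) → ℝ => x₀ + t • z)
      (t • ContinuousLinearMap.id ℝ (Fin (m + 1) → ℝ)) z :=
    ((hasFDerivAt_id z).const_smul t).const_add x₀
  have hGd z (hz : 0 < z l) : HasFDerivAt (fun z => G (x₀ + t • z))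
      ((fderiv ℝ G (x₀ + t • z)).comp (t • ContinuousLinearMap.id ℝ (Fin (m + 1) → ℝ))) z :=
    HasFDerivAt.comp (g := G) z (h.differentiableAt_field (x₀ + t • z)
      (by rw [hl]; positivity)).hasFDerivAt (hmap z)
  have hGc : ContinuousOn G {z | 0 ≤ z l} := by
    refine continuousOn_pi.2 fun i => (continuous_apply_rpow l ha.le).continuousOn.mul ?_
    exact h.continuousOn_deriv.clm_apply continuousOn_const
  have key := integral_field_mul_radial_eq_zero l (G := fun z => G (x₀ + t • z))
    (hGc.comp (by fun_prop) fun z (hz : 0 ≤ z l) => by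
      simp only [mem_ofPred_eq, hl]; positivity)
    (fun z hz => (hGd z hz).differentiableAt)
    (fun z hz => by
      rw [(hGd z hz).fderiv]
      have := h.divergence_eq_zero (x₀ + t • z) (by rw [hl]; positivity)
      simp only [ContinuousLinearMap.comp_apply, _root_.smul_apply, ContinuousLinearMap.id_apply,
        map_smul, Pi.smul_apply, smul_eq_mul, ← Finset.mul_sum]
      rw [this, mul_zero])
    (fun z hz => by
      ext i
      simp [hG, hx₀, hz, Real.zero_rpow ha.ne']) hg hM hgM
  -- As `x₀ l = 0`, the weight at `x₀ + t • z` is `t ^ a * z l ^ a`, and the factor `t ^ a` divides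
  -- out.
  have hta : t ^ a ≠ 0 := (Real.rpow_pos_of_pos ht a).ne'
  have hcongr : ∫ z in halfCube l M, t ^ a * (z l ^ a * (D (x₀ + t • z) z * g (sqLength z))) =
      ∫ z in halfCube l M, ∑ i, G (x₀ + t • z) i * (z i * g (sqLength z)) := by
    refine setIntegral_congr_fun (isCompact_halfCube l M).measurableSet fun z hz => ?_
    have hz0 := nonneg_of_mem_halfCube hz
    have hD (T : (Fin (m + 1) → ℝ) →L[ℝ] ℝ) : T z = ∑ i, z i * T (Pi.single i 1) := by
      conv_lhs => rw [← Finset.univ_sum_single z]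
      rw [map_sum]
      refine Finset.sum_congr rfl fun i _ => ?_
      rw [← smul_eq_mul, ← map_smul, ← Pi.single_smul, smul_eq_mul, mul_one]
    simp only [hG, hl, Real.mul_rpow ht.le hz0, hD (D _), Finset.sum_mul, Finset.mul_sum]
    exact Finset.sum_congr rfl fun i _ => by ring
  rw [key, integral_const_mul] at hcongr
  exact (mul_eq_zero.1 hcongr).resolve_left hta

lemma sub_eq_integral (h : IsWeightedHarmonic l a U D) {x₀ z : Fin (m + 1) → ℝ} (hx₀ : x₀ l = 0)
    (hz : 0 ≤ z l) : U (x₀ + z) - U x₀ = ∫ t in (0 : ℝ)..1, D (x₀ + t • z) z := by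
  have hmem (t : ℝ) (ht : 0 ≤ t) : x₀ + t • z ∈ {z : Fin (m + 1) → ℝ | 0 ≤ z l} := by
    simp only [mem_ofPred_eq, Pi.add_apply, Pi.smul_apply, smul_eq_mul, hx₀]; positivity
  have hmaps : MapsTo (fun t : ℝ => x₀ + t • z) (Icc 0 1) {z | 0 ≤ z l} :=
    fun t ht => hmem t ht.1
  rw [intervalIntegral.integral_eq_sub_of_hasDerivAt_of_le zero_le_one
    (f := fun t : ℝ => U (x₀ + t • z))]
  · simp
  · exact h.continuousOn.comp (by fun_prop) hmaps
  · intro t ht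
    have hd : HasDerivAt (fun t : ℝ => x₀ + t • z) z t := by
      simpa using ((hasDerivAt_id t).smul_const z).const_add x₀
    have h1 := (h.hasFDerivWithinAt _ (hmem t ht.1.le)).comp_hasDerivWithinAt (s := Ioo 0 1) t
      hd.hasDerivWithinAt fun s hs => hmem s hs.1.le
    exact h1.hasDerivAt (Ioo_mem_nhds ht.1 ht.2)
  · refine ContinuousOn.intervalIntegrable ?_
    rw [uIcc_of_le zero_le_one]
    exact (h.continuousOn_deriv.comp (by fun_prop) hmaps).clm_apply continuousOn_const

/-- Mean value property at boundary points. -/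
lemma integral_sub_mul_radial_eq_zero (h : IsWeightedHarmonic l a U D) (ha : 0 < a)
    {x₀ : Fin (m + 1) → ℝ} (hx₀ : x₀ l = 0) {g : ℝ → ℝ} (hg : Continuous g) {M : ℝ} (hM : 0 < M)
    (hgM : ∀ s, M ^ 2 ≤ s → g s = 0) :
    ∫ z in halfCube l M, z l ^ a * ((U (x₀ + z) - U x₀) * g (sqLength z)) = 0 := by
  have hK := isCompact_halfCube l M
  have hcont : ContinuousOn (fun p : (Fin (m + 1) → ℝ) × ℝ =>
      p.1 l ^ a * (D (x₀ + p.2 • p.1) p.1 * g (sqLength p.1))) (halfCube l M ×ˢ Icc (0 : ℝ) 1) := by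
    refine ((continuous_apply_rpow l ha.le).comp continuous_fst).continuousOn.mul
      (ContinuousOn.mul (ContinuousOn.clm_apply ?_ continuousOn_fst) (by fun_prop))
    refine h.continuousOn_deriv.comp (by fun_prop) fun p hp => ?_
    have h1 := nonneg_of_mem_halfCube hp.1
    have h2 := hp.2.1
    simp only [mem_ofPred_eq, Pi.add_apply, Pi.smul_apply, smul_eq_mul, hx₀]; positivity
  have hint : Integrable (Function.uncurry fun (z : Fin (m + 1) → ℝ) (t : ℝ) =>
      z l ^ a * (D (x₀ + t • z) z * g (sqLength z)))
      ((volume.restrict (halfCube l M)).prod (volume.restrict (Ioc (0 : ℝ) 1))) := by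
    rw [Measure.prod_restrict]
    exact (hcont.integrableOn_compact (hK.prod isCompact_Icc)).mono_set
      (prod_mono subset_rfl Ioc_subset_Icc_self)
  -- Integrate the derivative along the segment from `x₀` to `x₀ + z` and exchange the integrals:
  -- every slice with `t > 0` vanishes.
  calc ∫ z in halfCube l M, z l ^ a * ((U (x₀ + z) - U x₀) * g (sqLength z))
      = ∫ z in halfCube l M, ∫ t in Ioc (0 : ℝ) 1,
          z l ^ a * (D (x₀ + t • z) z * g (sqLength z)) := by
        refine setIntegral_congr_fun hK.measurableSet fun z hz => ?_
        simp only [h.sub_eq_integral hx₀ (nonneg_of_mem_halfCube hz),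
          intervalIntegral.integral_of_le zero_le_one, integral_const_mul, integral_mul_const]
    _ = ∫ t in Ioc (0 : ℝ) 1, ∫ z in halfCube l M,
          z l ^ a * (D (x₀ + t • z) z * g (sqLength z)) := integral_integral_swap hint
    _ = ∫ t in Ioc (0 : ℝ) 1, (0 : ℝ) :=
        setIntegral_congr_fun measurableSet_Ioc fun t ht =>
          h.integral_radial_deriv_eq_zero ha hx₀ hg hM hgM ht.1
    _ = 0 := by simp

end IsWeightedHarmonic

/-! ### Radial masses, translation and scaling -/

/-- The mass of the radial function `z ↦ g (|z|²)` for the weight `(z l) ^ a` on the half space. -/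
noncomputable def radialMass {m : ℕ} (l : Fin (m + 1)) (a : ℝ) (g : ℝ → ℝ) : ENNReal :=
  ∫⁻ z in {z : Fin (m + 1) → ℝ | 0 ≤ z l}, ENNReal.ofReal (z l ^ a * g (sqLength z))

lemma isClosed_halfSpace {m : ℕ} (l : Fin (m + 1)) :
    IsClosed {z : Fin (m + 1) → ℝ | 0 ≤ z l} :=
  isClosed_le continuous_const (continuous_apply l)

lemma lintegral_halfSpace_eq_halfCube {m : ℕ} {l : Fin (m + 1)} {M : ℝ} (hM : 0 ≤ M)
    {f : (Fin (m + 1) → ℝ) → ENNReal} (hf : ∀ z, M ^ 2 ≤ sqLength z → f z = 0) :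
    ∫⁻ z in {z : Fin (m + 1) → ℝ | 0 ≤ z l}, f z = ∫⁻ z in halfCube l M, f z := by
  rw [← lintegral_indicator (isClosed_halfSpace l).measurableSet,
    ← lintegral_indicator (isCompact_halfCube l M).measurableSet]
  congr 1 with z
  by_cases hz : z ∈ halfCube l M
  · rw [indicator_of_mem hz, indicator_of_mem (show z ∈ {z | 0 ≤ z l} from nonneg_of_mem_halfCube hz)]
  · rw [indicator_of_notMem hz]
    by_cases hl : 0 ≤ z l
    · rw [indicator_of_mem (show z ∈ {z | 0 ≤ z l} from hl)]
      refine hf z (not_lt.1 fun h => hz (mem_halfCube_of_sqLength_le hM hl h.le))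
    · rw [indicator_of_notMem (show z ∉ {z | 0 ≤ z l} from hl)]

lemma radialMass_eq_ofReal {m : ℕ} (l : Fin (m + 1)) {a : ℝ} (ha : 0 ≤ a) {g : ℝ → ℝ}
    (hg : Continuous g) (hg0 : ∀ s, 0 ≤ g s) {M : ℝ} (hM : 0 ≤ M)
    (hgM : ∀ s, M ^ 2 ≤ s → g s = 0) :
    radialMass l a g = ENNReal.ofReal (∫ z in halfCube l M, z l ^ a * g (sqLength z)) := by
  rw [radialMass, lintegral_halfSpace_eq_halfCube hM fun z hz => by simp [hgM _ hz],
    ofReal_integral_eq_lintegral_ofReal]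
  · exact ((continuous_apply_rpow l ha).mul
      (hg.comp continuous_sqLength)).continuousOn.integrableOn_compact (isCompact_halfCube l M)
  · filter_upwards [ae_restrict_mem (isCompact_halfCube l M).measurableSet] with z hz
    exact mul_nonneg (Real.rpow_nonneg (nonneg_of_mem_halfCube hz) a) (hg0 _)

lemma lintegral_halfSpace_add_left {m : ℕ} {l : Fin (m + 1)} {x₀ : Fin (m + 1) → ℝ}
    (hx₀ : x₀ l = 0) (f : (Fin (m + 1) → ℝ) → ENNReal) :
    ∫⁻ z in {z : Fin (m + 1) → ℝ | 0 ≤ z l}, f (x₀ + z) =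
      ∫⁻ z in {z : Fin (m + 1) → ℝ | 0 ≤ z l}, f z := by
  rw [← lintegral_indicator (isClosed_halfSpace l).measurableSet,
    ← lintegral_indicator (isClosed_halfSpace l).measurableSet,
    ← lintegral_add_left_eq_self ({z | 0 ≤ z l}.indicator f) x₀]
  congr 1 with z
  simp [indicator, hx₀]

/-- Mean value property at boundary points for nonnegative solutions. -/
lemma IsWeightedHarmonic.lintegral_mul_radial {m : ℕ} {l : Fin (m + 1)} {a : ℝ}
    {U : (Fin (m + 1) → ℝ) → ℝ} {D : (Fin (m + 1) → ℝ) → (Fin (m + 1) → ℝ) →L[ℝ] ℝ}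
    (h : IsWeightedHarmonic l a U D) (ha : 0 < a) (hU : ∀ z, 0 ≤ z l → 0 ≤ U z)
    {x₀ : Fin (m + 1) → ℝ} (hx₀ : x₀ l = 0) {g : ℝ → ℝ} (hg : Continuous g)
    (hg0 : ∀ s, 0 ≤ g s) {M : ℝ} (hM : 0 < M) (hgM : ∀ s, M ^ 2 ≤ s → g s = 0) :
    ∫⁻ z in {z : Fin (m + 1) → ℝ | 0 ≤ z l},
        ENNReal.ofReal (z l ^ a * (U z * g (sqLength (z - x₀)))) =
      ENNReal.ofReal (U x₀) * radialMass l a g := by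
  have hmem {z} (hz : z ∈ halfCube l M) : 0 ≤ (x₀ + z) l := by
    simpa [hx₀] using nonneg_of_mem_halfCube hz
  have hK := isCompact_halfCube l M
  have hi1 : IntegrableOn (fun z => z l ^ a * (U (x₀ + z) * g (sqLength z))) (halfCube l M) := by
    refine ContinuousOn.integrableOn_compact hK ?_
    refine (continuous_apply_rpow l ha.le).continuousOn.mul (ContinuousOn.mul ?_ (by fun_prop))
    exact h.continuousOn.comp (by fun_prop) fun z hz => hmem hz
  have hi2 : IntegrableOn (fun z => z l ^ a * g (sqLength z)) (halfCube l M) :=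
    ((continuous_apply_rpow l ha.le).mul
      (hg.comp continuous_sqLength)).continuousOn.integrableOn_compact hK
  have key := h.integral_sub_mul_radial_eq_zero ha hx₀ hg hM hgM
  have heq : ∫ z in halfCube l M, z l ^ a * (U (x₀ + z) * g (sqLength z)) =
      U x₀ * ∫ z in halfCube l M, z l ^ a * g (sqLength z) := by
    rw [← integral_const_mul, ← sub_eq_zero, ← integral_sub hi1 (hi2.const_mul _), ← key]
    congr 1 with z
    ring
  rw [radialMass_eq_ofReal l ha.le hg hg0 hM.le hgM,
    ← ENNReal.ofReal_mul (hU _ hx₀.ge), ← heq, ← lintegral_halfSpace_add_left hx₀]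
  simp only [add_sub_cancel_left, Pi.add_apply, hx₀, zero_add]
  rw [lintegral_halfSpace_eq_halfCube hM.le fun z hz => by simp [hgM _ hz],
    ofReal_integral_eq_lintegral_ofReal hi1]
  filter_upwards [ae_restrict_mem hK.measurableSet] with z hz
  exact mul_nonneg (Real.rpow_nonneg (nonneg_of_mem_halfCube hz) a)
    (mul_nonneg (hU _ (hmem hz)) (hg0 _))

lemma lintegral_halfSpace_smul {m : ℕ} (l : Fin (m + 1)) {R : ℝ} (hR : 0 < R)
    {f : (Fin (m + 1) → ℝ) → ENNReal} (hf : Measurable f) :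
    ∫⁻ z in {z : Fin (m + 1) → ℝ | 0 ≤ z l}, f z =
      ENNReal.ofReal (R ^ (m + 1)) *
        ∫⁻ z in {z : Fin (m + 1) → ℝ | 0 ≤ z l}, f (R • z) := by
  have hH := (isClosed_halfSpace l).measurableSet
  have h1 : ∫⁻ z in {z : Fin (m + 1) → ℝ | 0 ≤ z l}, f (R • z) =
      ∫⁻ z, {z : Fin (m + 1) → ℝ | 0 ≤ z l}.indicator f (R • z) := by
    rw [← lintegral_indicator hH]
    congr 1 with z
    simp [indicator, hR]
  rw [h1, ← lintegral_map (g := fun z => R • z) (hf.indicator hH) (measurable_const_smul R),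
    Measure.map_addHaar_smul _ hR.ne', lintegral_smul_measure, lintegral_indicator hH, smul_eq_mul,
    ← mul_assoc, ← ENNReal.ofReal_mul (by positivity), Module.finrank_fin_fun,
    abs_of_pos (by positivity), mul_inv_cancel₀ (by positivity), ENNReal.ofReal_one, one_mul]

/-- Dilation by `R` contributes `R ^ (m + 1)` from volume, `R ^ a` from the weight and `R ^ 2` from
the bump. -/
lemma radialMass_bump {m : ℕ} (l : Fin (m + 1)) {a : ℝ} {R : ℝ} (hR : 0 < R) :
    radialMass l a (fun s => max (R ^ 2 - s) 0) =
      ENNReal.ofReal (R ^ (m + 1) * (R ^ a * R ^ 2)) *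
        radialMass l a (fun s => max (1 - s) 0) := by
  rw [radialMass, lintegral_halfSpace_smul l hR, radialMass, ENNReal.ofReal_mul (by positivity),
    mul_assoc]
  · congr 1
    rw [← lintegral_const_mul']
    · refine setLIntegral_congr_fun (isClosed_halfSpace l).measurableSet fun z hz => ?_
      have h1 : sqLength (R • z) = R ^ 2 * sqLength z := by
        simp [sqLength, Finset.mul_sum, mul_pow]
      have h2 : max (R ^ 2 - R ^ 2 * sqLength z) 0 = R ^ 2 * max (1 - sqLength z) 0 := by
        rw [mul_max_of_nonneg _ _ (by positivity)]; ring_nf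
      simp only [h1, h2, Pi.smul_apply, smul_eq_mul, Real.mul_rpow hR.le hz]
      rw [← ENNReal.ofReal_mul (by positivity)]
      congr 1; ring
    · exact ENNReal.ofReal_ne_top
  · exact (((measurable_pi_apply l).pow_const a).mul (by fun_prop)).ennreal_ofReal

lemma radialMass_unit_bump_pos {m : ℕ} (l : Fin (m + 1)) (a : ℝ) :
    0 < radialMass l a (fun s => max (1 - s) 0) := by
  have hmeas : Measurable fun z : Fin (m + 1) → ℝ =>
      ENNReal.ofReal (z l ^ a * max (1 - sqLength z) 0) :=
    (((measurable_pi_apply l).pow_const a).mul (by fun_prop)).ennreal_ofReal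
  rw [radialMass, setLIntegral_pos_iff hmeas]
  set V : Set (Fin (m + 1) → ℝ) := {z | 0 < z l} ∩ {z | sqLength z < 1} with hV
  have hVo : IsOpen V := (isOpen_lt continuous_const (continuous_apply l)).inter
    (isOpen_lt continuous_sqLength continuous_const)
  have hVn : V.Nonempty := by
    refine ⟨Pi.single l (1 / 2), by simp, ?_⟩
    have : sqLength (Pi.single l (1 / 2) : Fin (m + 1) → ℝ) = (1 / 2) ^ 2 := by
      rw [sqLength, Finset.sum_eq_single l] <;> simp +contextual
    simp only [mem_ofPred_eq, this]; norm_num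
  refine (hVo.measure_pos volume hVn).trans_le (measure_mono fun z hz => ⟨?_, show 0 ≤ z l from le_of_lt hz.1⟩)
  have h1 : 0 < 1 - sqLength z := sub_pos.2 hz.2
  simp only [Function.mem_support, ne_eq, ENNReal.ofReal_eq_zero, not_le]
  exact mul_pos (Real.rpow_pos_of_pos hz.1 a) (lt_max_of_lt_left h1)

/-! ### Comparison of large balls and constancy on the boundary -/

/-- Weighted Young inequality: the difference of the two sides is `R⁻¹ |p - R q|²`. -/
lemma sqLength_le_add {ι : Type*} [Fintype ι] (p q : ι → ℝ) {R : ℝ} (hR : 0 < R) :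
    sqLength (p + q) ≤ (1 + R⁻¹) * sqLength p + (1 + R) * sqLength q := by
  simp only [sqLength, Finset.mul_sum, ← Finset.sum_add_distrib]
  refine Finset.sum_le_sum fun i _ => ?_
  have h : (1 + R⁻¹) * p i ^ 2 + (1 + R) * q i ^ 2 - (p + q) i ^ 2 =
      R⁻¹ * (p i - R * q i) ^ 2 := by
    simp only [Pi.add_apply]; field_simp; ring
  have : 0 ≤ R⁻¹ * (p i - R * q i) ^ 2 := by positivity
  linarith

/-- A form of the inclusion of the ball of radius `R` about `x₀` in a larger ball about `x₁`.
Enlarging the radius by `1 + |x₀ - x₁|²`, which exceeds `|x₀ - x₁|`, avoids square roots. -/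
lemma bump_sub_le {ι : Type*} [Fintype ι] (x₀ x₁ z : ι → ℝ) {R : ℝ} (hR : 0 < R) :
    max (R ^ 2 - sqLength (z - x₀)) 0 ≤
      max ((R + (1 + sqLength (x₀ - x₁))) ^ 2 - sqLength (z - x₁)) 0 := by
  rcases le_total (R ^ 2 - sqLength (z - x₀)) 0 with h | h
  · rw [max_eq_right h]; exact le_max_right _ _
  · rw [max_eq_left h]
    refine le_max_of_le_left ?_
    have h1 := sqLength_le_add (z - x₀) (x₀ - x₁) hR
    rw [sub_add_sub_cancel] at h1
    have h2 : R⁻¹ * sqLength (z - x₀) ≤ R := by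
      rw [inv_mul_le_iff₀ hR]; nlinarith
    have h3 := sqLength_nonneg (x₀ - x₁)
    nlinarith [mul_nonneg hR.le h3]

/-- A nonnegative solution is constant on the boundary. -/
lemma IsWeightedHarmonic.le_of_boundary {m : ℕ} {l : Fin (m + 1)} {a : ℝ}
    {U : (Fin (m + 1) → ℝ) → ℝ} {D : (Fin (m + 1) → ℝ) → (Fin (m + 1) → ℝ) →L[ℝ] ℝ}
    (h : IsWeightedHarmonic l a U D) (ha : 0 < a) (hU : ∀ z, 0 ≤ z l → 0 ≤ U z)
    {x₀ x₁ : Fin (m + 1) → ℝ} (hx₀ : x₀ l = 0) (hx₁ : x₁ l = 0) : U x₀ ≤ U x₁ := by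
  set B := 1 + sqLength (x₀ - x₁) with hB
  have hB0 : 0 < B := by have := sqLength_nonneg (x₀ - x₁); positivity
  set K := radialMass l a (fun s => max (1 - s) 0) with hK
  have hK0 : K ≠ 0 := (radialMass_unit_bump_pos l a).ne'
  have hKt : K ≠ ⊤ := by
    rw [hK, radialMass_eq_ofReal l ha.le (by fun_prop) (fun s => le_max_right _ _) zero_le_one
      fun s hs => max_eq_right (by linarith)]
    exact ENNReal.ofReal_ne_top
  have hmean {R : ℝ} (hR : 0 < R) {x : Fin (m + 1) → ℝ} (hx : x l = 0) :=
    h.lintegral_mul_radial ha hU hx (g := fun s => max (R ^ 2 - s) 0) (by fun_prop)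
      (fun s => le_max_right _ _) hR fun s hs => max_eq_right (by linarith)
  -- The last factor is the ratio of the bump masses at radii `R + B` and `R`; it tends to 1 as `R`
  -- grows.
  have hbound (R : ℝ) (hR : 0 < R) :
      U x₀ ≤ U x₁ * ((1 + B / R) ^ (m + 1) * ((1 + B / R) ^ a * (1 + B / R) ^ 2)) := by
    have h1 : ENNReal.ofReal (U x₀) * radialMass l a (fun s => max (R ^ 2 - s) 0) ≤
        ENNReal.ofReal (U x₁) * radialMass l a (fun s => max ((R + B) ^ 2 - s) 0) := by
      rw [← hmean hR hx₀, ← hmean (by positivity) hx₁]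
      refine setLIntegral_mono' (isClosed_halfSpace l).measurableSet fun z hz => ?_
      refine ENNReal.ofReal_le_ofReal ?_
      have := bump_sub_le x₀ x₁ z hR
      have h2 := Real.rpow_nonneg (show 0 ≤ z l from hz) a
      have h3 := hU z hz
      gcongr
    have hU1 := hU x₁ hx₁.ge
    rw [radialMass_bump l hR, radialMass_bump l (by positivity), ← mul_assoc (ENNReal.ofReal _),
      ← mul_assoc (ENNReal.ofReal (U x₁)), ENNReal.mul_le_mul_iff_left hK0 hKt, ← ENNReal.ofReal_mul (hU x₀ hx₀.ge),
      ← ENNReal.ofReal_mul hU1, ENNReal.ofReal_le_ofReal_iff (by positivity)] at h1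
    have h4 : R + B = R * (1 + B / R) := by field_simp
    rw [h4, Real.mul_rpow hR.le (by positivity), mul_pow, mul_pow] at h1
    have h5 : 0 < R ^ (m + 1) * (R ^ a * R ^ 2) := by positivity
    refine le_of_mul_le_mul_right (h1.trans_eq ?_) h5
    ring
  have hlim : Tendsto (fun R : ℝ =>
      U x₁ * ((1 + B / R) ^ (m + 1) * ((1 + B / R) ^ a * (1 + B / R) ^ 2))) atTop
      (𝓝 (U x₁ * ((1 + 0) ^ (m + 1) * ((1 + 0) ^ a * (1 + 0) ^ 2)))) := by
    have h0 : Tendsto (fun R : ℝ => 1 + B / R) atTop (𝓝 (1 + 0)) :=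
      tendsto_const_nhds.add (tendsto_const_nhds.div_atTop tendsto_id)
    exact tendsto_const_nhds.mul ((h0.pow _).mul ((h0.rpow_const (by simp)).mul (h0.pow _)))
  refine (ge_of_tendsto hlim ((eventually_gt_atTop 0).mono hbound)).trans_eq ?_
  simp

/-! ### Gaussian mean values -/

lemma isWeightedHarmonic_const {m : ℕ} (l : Fin (m + 1)) (a c : ℝ) :
    IsWeightedHarmonic l a (fun _ => c) 0 where
  hasFDerivWithinAt z _ := hasFDerivWithinAt_const c z _
  continuousOn_deriv := continuousOn_const
  differentiableAt_field z _ := by simp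
  divergence_eq_zero z _ := by
    simp only [Pi.zero_apply, _root_.zero_apply, mul_zero]
    simp

/-- With `s = z l`, one has `s ^ a ≤ exp s` and `s ≤ 1/2 + s²/2`, so the integrand is at most `exp
(1/2) exp (-|z|²/2)`, a product of one-variable Gaussians. -/
lemma radialMass_gaussian_ne_top {m : ℕ} (l : Fin (m + 1)) {a : ℝ} (ha0 : 0 ≤ a) (ha1 : a ≤ 1) :
    radialMass l a (fun s => Real.exp (-s)) ≠ ⊤ := by
  have hint : Integrable fun z : Fin (m + 1) → ℝ =>
      Real.exp (1 / 2) * ∏ i, Real.exp (-(1 / 2) * z i ^ 2) :=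
    (Integrable.fintype_prod fun _ => integrable_exp_neg_mul_sq (by norm_num)).const_mul _
  refine ne_top_of_le_ne_top hint.integrableOn.lintegral_lt_top.ne
    (setLIntegral_mono' (isClosed_halfSpace l).measurableSet fun z hz => ?_)
  refine ENNReal.ofReal_le_ofReal ?_
  have hz0 : 0 ≤ z l := hz
  have h1 : z l ^ a ≤ Real.exp (z l) := by
    rcases le_total (z l) 1 with h | h
    · exact (Real.rpow_le_one hz0 h ha0).trans (Real.one_le_exp hz0)
    · calc z l ^ a ≤ z l ^ (1 : ℝ) := Real.rpow_le_rpow_of_exponent_le h ha1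
        _ ≤ Real.exp (z l) := by rw [Real.rpow_one]; linarith [Real.add_one_le_exp (z l)]
  have h2 : ∏ i, Real.exp (-(1 / 2) * z i ^ 2) = Real.exp (-(1 / 2) * sqLength z) := by
    rw [← Real.exp_sum, sqLength, Finset.mul_sum]
  rw [h2, ← Real.exp_add]
  refine (mul_le_mul_of_nonneg_right h1 (Real.exp_pos _).le).trans ?_
  rw [← Real.exp_add, Real.exp_le_exp]
  nlinarith [sq_le_sqLength z l, sq_nonneg (z l - 1)]

namespace IsWeightedHarmonic

variable {m : ℕ} {l : Fin (m + 1)} {a : ℝ} {U : (Fin (m + 1) → ℝ) → ℝ}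
  {D : (Fin (m + 1) → ℝ) → (Fin (m + 1) → ℝ) →L[ℝ] ℝ}

lemma lintegral_mul_gaussian (h : IsWeightedHarmonic l a U D) (ha : 0 < a)
    (hU : ∀ z, 0 ≤ z l → 0 ≤ U z) {x₀ : Fin (m + 1) → ℝ} (hx₀ : x₀ l = 0) {τ : ℝ} (hτ : 0 < τ) :
    ∫⁻ z in {z : Fin (m + 1) → ℝ | 0 ≤ z l},
        ENNReal.ofReal (z l ^ a * (U z * Real.exp (-τ * sqLength (z - x₀)))) =
      ENNReal.ofReal (U x₀) * radialMass l a (fun s => Real.exp (-τ * s)) := by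
  have hH := (isClosed_halfSpace l).measurableSet
  -- Continuous truncations, zero beyond radius `k + 1` (positive also for `k = 0`), which increase
  -- to the Gaussian; monotone convergence applies on both sides.
  set g : ℕ → ℝ → ℝ := fun k s => max (Real.exp (-τ * s) - Real.exp (-τ * ((k : ℝ) + 1) ^ 2)) 0
    with hg
  have hgc k : Continuous (g k) := by simp only [hg]; fun_prop
  have hg0 k s : 0 ≤ g k s := le_max_right _ _
  have hgM (k : ℕ) (s : ℝ) (hs : ((k : ℝ) + 1) ^ 2 ≤ s) : g k s = 0 := by
    refine max_eq_right (sub_nonpos.2 (Real.exp_le_exp.2 ?_))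
    have := mul_le_mul_of_nonneg_left hs hτ.le
    linarith
  have hgmono s : Monotone fun k => g k s := by
    intro j k hjk
    have h1 : ((j : ℝ) + 1) ^ 2 ≤ ((k : ℝ) + 1) ^ 2 := by gcongr
    have h2 : Real.exp (-τ * ((k : ℝ) + 1) ^ 2) ≤ Real.exp (-τ * ((j : ℝ) + 1) ^ 2) :=
      Real.exp_le_exp.2 (by nlinarith)
    simp only [hg]; gcongr
  have hglim s : Tendsto (fun k => g k s) atTop (𝓝 (Real.exp (-τ * s))) := by
    have h1 : Tendsto (fun k : ℕ => τ * ((k : ℝ) + 1) ^ 2) atTop atTop :=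
      ((tendsto_pow_atTop two_ne_zero).comp
        (tendsto_atTop_add_const_right _ 1 tendsto_natCast_atTop_atTop)).const_mul_atTop hτ
    have h2 := (tendsto_const_nhds (x := Real.exp (-τ * s))).sub
      (Real.tendsto_exp_neg_atTop_nhds_zero.comp h1)
    have h3 := h2.max (tendsto_const_nhds (x := (0 : ℝ)))
    rw [sub_zero, max_eq_left (Real.exp_pos _).le] at h3
    simpa [hg, Function.comp_def] using h3
  have hlhs := lintegral_tendsto_of_tendsto_of_monotone
    (μ := volume.restrict {z : Fin (m + 1) → ℝ | 0 ≤ z l})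
    (f := fun k z => ENNReal.ofReal (z l ^ a * (U z * g k (sqLength (z - x₀)))))
    (F := fun z => ENNReal.ofReal (z l ^ a * (U z * Real.exp (-τ * sqLength (z - x₀)))))
    (fun k => (ContinuousOn.aemeasurable ((continuous_apply_rpow l ha.le).continuousOn.mul
      (h.continuousOn.mul ((hgc k).comp
        (continuous_sqLength.comp (continuous_id.sub continuous_const))).continuousOn))
      hH).ennreal_ofReal)
    (by
      filter_upwards [ae_restrict_mem hH] with z hz j k hjk
      refine ENNReal.ofReal_le_ofReal ?_
      have h1 := Real.rpow_nonneg (show 0 ≤ z l from hz) a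
      have h2 := hU z hz
      have h3 := hgmono (sqLength (z - x₀)) hjk
      gcongr)
    (Eventually.of_forall fun z => ENNReal.tendsto_ofReal
      (tendsto_const_nhds.mul (tendsto_const_nhds.mul (hglim _))))
  have hrhs := lintegral_tendsto_of_tendsto_of_monotone
    (μ := volume.restrict {z : Fin (m + 1) → ℝ | 0 ≤ z l})
    (f := fun k z => ENNReal.ofReal (z l ^ a * g k (sqLength z)))
    (F := fun z => ENNReal.ofReal (z l ^ a * Real.exp (-τ * sqLength z)))
    (fun k => ((continuous_apply_rpow l ha.le).mul
      ((hgc k).comp continuous_sqLength)).measurable.ennreal_ofReal.aemeasurable)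
    (by
      filter_upwards [ae_restrict_mem hH] with z hz j k hjk
      refine ENNReal.ofReal_le_ofReal ?_
      have h1 := Real.rpow_nonneg (show 0 ≤ z l from hz) a
      have h3 := hgmono (sqLength z) hjk
      gcongr)
    (Eventually.of_forall fun z => ENNReal.tendsto_ofReal
      (tendsto_const_nhds.mul (hglim _)))
  refine tendsto_nhds_unique hlhs ?_
  have hk k := h.lintegral_mul_radial ha hU hx₀ (hgc k) (hg0 k)
    (M := (k : ℝ) + 1) (by positivity) (hgM k)
  simp only [hk]
  exact ENNReal.Tendsto.const_mul hrhs (Or.inr ENNReal.ofReal_ne_top)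

/-- Completing the square turns the exponential into a multiple of a Gaussian centred at `w / (2τ)`,
a boundary point because `w l = 0`. -/
lemma lintegral_mul_exp (h : IsWeightedHarmonic l a U D) (ha : 0 < a)
    (hU : ∀ z, 0 ≤ z l → 0 ≤ U z) {c : ℝ} (hc : ∀ z, z l = 0 → U z = c)
    {κ τ : ℝ} (hτ : 0 < τ) {w : Fin (m + 1) → ℝ} (hw : w l = 0) :
    ∫⁻ z in {z : Fin (m + 1) → ℝ | 0 ≤ z l},
        ENNReal.ofReal (z l ^ a * (U z * Real.exp (κ - τ * sqLength z + ∑ i, w i * z i))) =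
      ENNReal.ofReal (Real.exp (κ + τ * sqLength ((2 * τ)⁻¹ • w))) *
        (ENNReal.ofReal c * radialMass l a (fun s => Real.exp (-τ * s))) := by
  set x₀ := (2 * τ)⁻¹ • w with hx
  have hx₀ : x₀ l = 0 := by simp [hx, hw]
  rw [← hc x₀ hx₀, ← h.lintegral_mul_gaussian ha hU hx₀ hτ,
    ← lintegral_const_mul' _ _ ENNReal.ofReal_ne_top]
  congr 1 with z
  rw [← ENNReal.ofReal_mul (Real.exp_pos _).le]
  have h1 : κ - τ * sqLength z + ∑ i, w i * z i =
      (κ + τ * sqLength x₀) + -τ * sqLength (z - x₀) := by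
    simp only [sqLength, Finset.mul_sum, add_assoc, sub_eq_add_neg, ← Finset.sum_neg_distrib,
      ← Finset.sum_add_distrib]
    congr 1
    refine Finset.sum_congr rfl fun i _ => ?_
    simp only [hx, Pi.add_apply, Pi.neg_apply, Pi.smul_apply, smul_eq_mul]
    field_simp
    ring
  rw [h1, Real.exp_add]
  congr 1
  ring

end IsWeightedHarmonic

/-! ### The algebra of tangential Gaussians -/

/-- The bounded functions `z ↦ exp (κ - t |z|² + ⟨w, z⟩)` on the closed half space, with `w`
tangential. -/
def tangentialGaussians {m : ℕ} (l : Fin (m + 1)) :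
    Submonoid (BoundedContinuousFunction {z : Fin (m + 1) → ℝ // 0 ≤ z l} ℝ) where
  -- The value `t = 0` is allowed so that the constant 1 belongs; boundedness then forces `w = 0`.
  carrier := {f | ∃ κ t : ℝ, ∃ w : Fin (m + 1) → ℝ, 0 ≤ t ∧ w l = 0 ∧
    ∀ z, f z = Real.exp (κ - t * sqLength z.1 + ∑ i, w i * z.1 i)}
  one_mem' := ⟨0, 0, 0, le_rfl, rfl, fun z => by simp⟩
  mul_mem' := by
    rintro f g ⟨κ, t, w, ht, hw, hf⟩ ⟨κ', t', w', ht', hw', hg⟩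
    refine ⟨κ + κ', t + t', w + w', by positivity, by simp [hw, hw'], fun z => ?_⟩
    rw [BoundedContinuousFunction.mul_apply, hf, hg, ← Real.exp_add]
    congr 1
    simp only [Pi.add_apply, add_mul, Finset.sum_add_distrib]
    ring

/-- The translated Gaussian `z ↦ exp (-|z - x₀|²)` as a bounded function on the half space. -/
noncomputable def boundedGaussian {m : ℕ} (l : Fin (m + 1)) (x₀ : Fin (m + 1) → ℝ) :
    BoundedContinuousFunction {z : Fin (m + 1) → ℝ // 0 ≤ z l} ℝ :=
  BoundedContinuousFunction.ofNormedAddCommGroup (fun z => Real.exp (-sqLength (z.1 - x₀)))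
    (by fun_prop) 1 fun z => by
      rw [Real.norm_of_nonneg (Real.exp_pos _).le, Real.exp_le_one_iff]
      simpa using sqLength_nonneg _

lemma sqLength_sub {ι : Type*} [Fintype ι] (z x : ι → ℝ) :
    sqLength (z - x) = sqLength z - 2 * ∑ i, x i * z i + sqLength x := by
  simp only [sqLength, Finset.mul_sum, ← Finset.sum_sub_distrib, ← Finset.sum_add_distrib]
  exact Finset.sum_congr rfl fun i _ => by simp only [Pi.sub_apply]; ring

lemma boundedGaussian_mem {m : ℕ} {l : Fin (m + 1)} {x₀ : Fin (m + 1) → ℝ} (hx₀ : x₀ l = 0) :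
    boundedGaussian l x₀ ∈ tangentialGaussians l := by
  refine ⟨-sqLength x₀, 1, (2 : ℝ) • x₀, zero_le_one, by simp [hx₀], fun z => ?_⟩
  change Real.exp (-sqLength (z.1 - x₀)) = _
  rw [sqLength_sub]
  simp only [Pi.smul_apply, smul_eq_mul, mul_assoc, ← Finset.mul_sum]
  congr 1; ring

/-- The star algebra generated by the tangential Gaussians. -/
noncomputable def tangentialGaussianAlgebra {m : ℕ} (l : Fin (m + 1)) :
    StarSubalgebra ℝ (BoundedContinuousFunction {z : Fin (m + 1) → ℝ // 0 ≤ z l} ℝ) :=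
  { Algebra.adjoin ℝ (tangentialGaussians l : Set _) with
    star_mem' := fun {f} hf => by
      have : star f = f := by ext z; simp
      rwa [this] }

/-- Distances to the origin and to the tangential unit vectors determine the tangential coordinates,
hence the square of the normal one, which is nonnegative. -/
lemma separatesPoints_tangentialGaussianAlgebra {m : ℕ} (l : Fin (m + 1)) :
    ((tangentialGaussianAlgebra l).map
      (BoundedContinuousFunction.toContinuousMapStarₐ ℝ)).SeparatesPoints := by
  intro x y hxy
  suffices h : ∃ x₀ : Fin (m + 1) → ℝ, x₀ l = 0 ∧ sqLength (x.1 - x₀) ≠ sqLength (y.1 - x₀) by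
    obtain ⟨x₀, hx₀, hne⟩ := h
    refine ⟨boundedGaussian l x₀, ?_, fun heq => hne (neg_injective (Real.exp_injective heq))⟩
    exact ⟨_, ⟨_, Algebra.subset_adjoin (boundedGaussian_mem hx₀), rfl⟩, rfl⟩
  by_contra! hall
  have h0 : sqLength x.1 = sqLength y.1 := by simpa using hall 0 rfl
  have hi i (hi : i ≠ l) : x.1 i = y.1 i := by
    have h1 := hall (Pi.single i 1) (by simp [hi.symm])
    simp only [sqLength_sub, h0, Pi.single_apply, ite_mul, one_mul, zero_mul,
      Finset.sum_ite_eq', Finset.mem_univ, if_true] at h1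
    linarith
  refine hxy (Subtype.ext (funext fun i => ?_))
  by_cases hil : i = l
  · subst hil
    have h2 : ∑ j ∈ Finset.univ.erase i, x.1 j ^ 2 = ∑ j ∈ Finset.univ.erase i, y.1 j ^ 2 :=
      Finset.sum_congr rfl fun j hj => by rw [hi j (Finset.ne_of_mem_erase hj)]
    rw [sqLength, sqLength, ← Finset.add_sum_erase _ _ (Finset.mem_univ i),
      ← Finset.add_sum_erase _ _ (Finset.mem_univ i), h2, add_left_inj] at h0
    exact (sq_eq_sq₀ x.2 y.2).1 h0
  · exact hi i hil

/-! ### Equality of the Gaussian measures and the Liouville theorem -/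

lemma lintegral_subtype_halfSpace {m : ℕ} (l : Fin (m + 1))
    (f : (Fin (m + 1) → ℝ) → ENNReal) :
    ∫⁻ z : {z : Fin (m + 1) → ℝ // 0 ≤ z l}, f z.1 ∂(Measure.comap Subtype.val volume) =
      ∫⁻ z in {z : Fin (m + 1) → ℝ | 0 ≤ z l}, f z :=
  lintegral_subtype_comap (isClosed_halfSpace l).measurableSet f

/-- The measure `(z l) ^ a V(z) exp (-|z|²) dz` on the closed half space. -/
noncomputable def gaussianMeasure {m : ℕ} (l : Fin (m + 1)) (a : ℝ) (V : (Fin (m + 1) → ℝ) → ℝ) :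
    Measure {z : Fin (m + 1) → ℝ // 0 ≤ z l} :=
  (Measure.comap Subtype.val volume).withDensity fun z =>
    ENNReal.ofReal (z.1 l ^ a * (V z.1 * Real.exp (-sqLength z.1)))

namespace IsWeightedHarmonic

variable {m : ℕ} {l : Fin (m + 1)} {a : ℝ} {U : (Fin (m + 1) → ℝ) → ℝ}
  {D : (Fin (m + 1) → ℝ) → (Fin (m + 1) → ℝ) →L[ℝ] ℝ}

lemma measurable_density (h : IsWeightedHarmonic l a U D) (ha : 0 < a) :
    Measurable fun z : {z : Fin (m + 1) → ℝ // 0 ≤ z l} =>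
      ENNReal.ofReal (z.1 l ^ a * (U z.1 * Real.exp (-sqLength z.1))) := by
  have h1 : Continuous fun z : {z : Fin (m + 1) → ℝ // 0 ≤ z l} => U z.1 :=
    continuousOn_iff_continuous_domRestrict.1 h.continuousOn
  have h2 : Continuous fun z : {z : Fin (m + 1) → ℝ // 0 ≤ z l} => z.1 l ^ a :=
    (continuous_apply_rpow l ha.le).comp continuous_subtype_val
  exact (h2.mul (h1.mul (by fun_prop))).measurable.ennreal_ofReal

lemma lintegral_density_ne_top (h : IsWeightedHarmonic l a U D) (ha0 : 0 < a) (ha1 : a ≤ 1)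
    (hU : ∀ z, 0 ≤ z l → 0 ≤ U z) :
    ∫⁻ z : {z : Fin (m + 1) → ℝ // 0 ≤ z l},
      ENNReal.ofReal (z.1 l ^ a * (U z.1 * Real.exp (-sqLength z.1)))
        ∂(Measure.comap Subtype.val volume) ≠ ⊤ := by
  have h1 := h.lintegral_mul_gaussian ha0 hU (x₀ := 0) rfl one_pos
  simp only [sub_zero, neg_mul, one_mul] at h1
  rw [lintegral_subtype_halfSpace l
    (fun z => ENNReal.ofReal (z l ^ a * (U z * Real.exp (-sqLength z)))), h1]
  exact ENNReal.mul_ne_top ENNReal.ofReal_ne_top (radialMass_gaussian_ne_top l ha0.le ha1)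

/-- The factor `exp (-|z|²)` of the measure raises `t` to `1 + t > 0`, so Gaussian mean values apply
even for `t = 0`. The result depends on `U` only through `c`. -/
lemma integral_tangentialGaussian (h : IsWeightedHarmonic l a U D) (ha : 0 < a)
    (hU : ∀ z, 0 ≤ z l → 0 ≤ U z) {c : ℝ} (hc : ∀ z, z l = 0 → U z = c)
    {κ t : ℝ} (ht : 0 ≤ t) {w : Fin (m + 1) → ℝ} (hw : w l = 0)
    {f : BoundedContinuousFunction {z : Fin (m + 1) → ℝ // 0 ≤ z l} ℝ}
    (hf : ∀ z, f z = Real.exp (κ - t * sqLength z.1 + ∑ i, w i * z.1 i)) :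
    ∫ z, f z ∂gaussianMeasure l a U =
      (ENNReal.ofReal (Real.exp (κ + (1 + t) * sqLength ((2 * (1 + t))⁻¹ • w))) *
        (ENNReal.ofReal c * radialMass l a (fun s => Real.exp (-(1 + t) * s)))).toReal := by
  have hf0 z : 0 ≤ f z := by rw [hf]; exact (Real.exp_pos _).le
  rw [integral_eq_lintegral_of_nonneg_ae (Eventually.of_forall hf0)
    f.continuous.aestronglyMeasurable, gaussianMeasure,
    lintegral_withDensity_eq_lintegral_mul _ (h.measurable_density ha)
      f.continuous.measurable.ennreal_ofReal,
    ← h.lintegral_mul_exp ha hU hc (by positivity) hw,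
    ← lintegral_subtype_halfSpace l]
  congr 2 with z
  rw [Pi.mul_apply, ← ENNReal.ofReal_mul, hf, mul_assoc, mul_assoc, ← Real.exp_add]
  · congr 4; ring
  · exact mul_nonneg (Real.rpow_nonneg z.2 a) (mul_nonneg (hU _ z.2) (Real.exp_pos _).le)

lemma gaussianMeasure_eq_const (h : IsWeightedHarmonic l a U D) (ha0 : 0 < a) (ha1 : a ≤ 1)
    (hU : ∀ z, 0 ≤ z l → 0 ≤ U z) {c : ℝ} (hc : ∀ z, z l = 0 → U z = c) :
    gaussianMeasure l a U = gaussianMeasure l a fun _ => c := by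
  have hc0 : 0 ≤ c := hc 0 rfl ▸ hU 0 le_rfl
  have h' := isWeightedHarmonic_const l a c
  have : IsFiniteMeasure (gaussianMeasure l a U) :=
    isFiniteMeasure_withDensity (h.lintegral_density_ne_top ha0 ha1 hU)
  have : IsFiniteMeasure (gaussianMeasure l a fun _ => c) :=
    isFiniteMeasure_withDensity (h'.lintegral_density_ne_top ha0 ha1 fun _ _ => hc0)
  have : PolishSpace {z : Fin (m + 1) → ℝ // 0 ≤ z l} := (isClosed_halfSpace l).polishSpace
  refine ext_of_forall_mem_subalgebra_integral_eq_of_polish (𝕜 := ℝ)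
    (separatesPoints_tangentialGaussianAlgebra l) fun f hf => ?_
  -- The generators are closed under multiplication, so the algebra is their linear span and it
  -- suffices to compare integrals of generators.
  have hf' : f ∈ Submodule.span ℝ
      (tangentialGaussians l : Set (BoundedContinuousFunction _ ℝ)) := by
    have h1 : f ∈ Subalgebra.toSubmodule
      (Algebra.adjoin ℝ (tangentialGaussians l : Set (BoundedContinuousFunction _ ℝ))) := hf
    rwa [Algebra.adjoin_eq_span, Submonoid.closure_eq] at h1
  clear hf
  induction hf' using Submodule.span_induction with
  | mem f hf =>
    obtain ⟨κ, t, w, ht, hw, hf⟩ := hf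
    rw [h.integral_tangentialGaussian ha0 hU hc ht hw hf,
      h'.integral_tangentialGaussian ha0 (fun _ _ => hc0) (fun _ _ => rfl) ht hw hf]
  | zero => simp
  | add f g _ _ hf hg =>
    simp only [BoundedContinuousFunction.coe_add, Pi.add_apply]
    rw [integral_add (f.integrable _) (g.integrable _),
      integral_add (f.integrable _) (g.integrable _), hf, hg]
  | smul r f _ hf =>
    simp only [BoundedContinuousFunction.coe_smul]
    rw [integral_smul, integral_smul, hf]

/-- Liouville theorem in coordinates. -/
lemma eq_apply_zero (h : IsWeightedHarmonic l a U D) (ha0 : 0 < a) (ha1 : a ≤ 1)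
    (hU : ∀ z, 0 ≤ z l → 0 ≤ U z) {z : Fin (m + 1) → ℝ} (hz : 0 ≤ z l) : U z = U 0 := by
  set c := U 0
  have hc z (hz : z l = 0) : U z = c :=
    le_antisymm (h.le_of_boundary ha0 hU hz rfl) (h.le_of_boundary ha0 hU rfl hz)
  rcases hz.eq_or_lt with hz | hz
  · exact hc z hz.symm
  have hc0 : 0 ≤ c := hU 0 le_rfl
  have h' := isWeightedHarmonic_const l a c
  have h1 := (withDensity_eq_iff (h.measurable_density ha0).aemeasurable
    (h'.measurable_density ha0).aemeasurable (h.lintegral_density_ne_top ha0 ha1 hU)).1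
    (h.gaussianMeasure_eq_const ha0 ha1 hU hc)
  have h2 := (ae_restrict_iff_subtype (isClosed_halfSpace l).measurableSet
    (p := fun z => ENNReal.ofReal (z l ^ a * (U z * Real.exp (-sqLength z))) =
      ENNReal.ofReal (z l ^ a * (c * Real.exp (-sqLength z))))).2 h1
  have hsub : {z : Fin (m + 1) → ℝ | 0 < z l} ⊆ {z | 0 ≤ z l} :=
    fun z (hz : 0 < z l) => hz.le
  have hopen : IsOpen {z : Fin (m + 1) → ℝ | 0 < z l} :=
    isOpen_lt continuous_const (continuous_apply l)
  -- The weight can be cancelled only where `z l > 0`.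
  have h3 : U =ᵐ[volume.restrict {z : Fin (m + 1) → ℝ | 0 < z l}] fun _ => c := by
    filter_upwards [ae_restrict_of_ae_restrict_of_subset hsub h2,
      ae_restrict_mem hopen.measurableSet] with z hz hzl
    have hzl' : 0 < z l := hzl
    have h4 := hU z hzl'.le
    rw [ENNReal.ofReal_eq_ofReal_iff (by positivity) (by positivity)] at hz
    have h5 := mul_left_cancel₀ (Real.rpow_pos_of_pos hzl' a).ne' hz
    exact mul_right_cancel₀ (Real.exp_pos _).ne' h5
  exact Measure.eqOn_open_of_ae_eq h3 hopen (h.continuousOn.mono hsub) continuousOn_const hz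

end IsWeightedHarmonic

/-! ### Transfer from Euclidean space to coordinates -/

lemma closure_upperHalfSpace (n : ℕ) [NeZero n] :
    closure (upperHalfSpace n) = {x | 0 ≤ x (lastIdx n)} := by
  have ho : IsOpenMap fun x : EuclideanSpace ℝ (Fin n) => x (lastIdx n) :=
    (isOpenMap_eval (lastIdx n)).comp
      (PiLp.continuousLinearEquiv 2 ℝ fun _ : Fin n => ℝ).toHomeomorph.isOpenMap
  have h := ho.preimage_closure_eq_closure_preimage (by fun_prop) (Ioi (0 : ℝ))
  rw [closure_Ioi] at h
  exact h.symm

lemma isOpen_upperHalfSpace (n : ℕ) [NeZero n] : IsOpen (upperHalfSpace n) :=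
  isOpen_lt continuous_const (by fun_prop)

lemma uniqueDiffOn_closure_upperHalfSpace (n : ℕ) [NeZero n] :
    UniqueDiffOn ℝ (closure (upperHalfSpace n)) := by
  refine uniqueDiffOn_convex (Convex.closure fun x hx y hy s t hs ht hst => ?_)
    ⟨EuclideanSpace.single (lastIdx n) 1, ?_⟩
  · exact (convex_Ioi (0 : ℝ)) hx hy hs ht hst
  · refine interior_maximal subset_closure (isOpen_upperHalfSpace n) ?_
    change 0 < (EuclideanSpace.single (lastIdx n) (1 : ℝ)) (lastIdx n)
    simp

lemma gradient_apply_eq_fderiv {n : ℕ} (u : EuclideanSpace ℝ (Fin n) → ℝ)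
    (x : EuclideanSpace ℝ (Fin n)) (i : Fin n) :
    gradient u x i = fderiv ℝ u x (EuclideanSpace.single i 1) := by
  have h : inner ℝ (gradient u x) (EuclideanSpace.single i (1 : ℝ)) =
      fderiv ℝ u x (EuclideanSpace.single i 1) := by
    rw [gradient, InnerProductSpace.toDual_symm_apply]
  rw [← h, EuclideanSpace.inner_single_right]
  simp

/-- The derivative within the closed half space is continuous up to the boundary and equals the full
derivative inside, where the coordinate field is thus the transported `x_n ^ a ∇u`. -/
lemma isWeightedHarmonic_of_weightedLaplacian_eq_zero {m : ℕ} {a : ℝ}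
    {u : EuclideanSpace ℝ (Fin (m + 1)) → ℝ}
    (hu2 : ContDiffOn ℝ 2 u (upperHalfSpace (m + 1)))
    (hu1 : ContDiffOn ℝ 1 u (closure (upperHalfSpace (m + 1))))
    (heq : ∀ x ∈ upperHalfSpace (m + 1), weightedLaplacian a u x = 0) :
    IsWeightedHarmonic (lastIdx (m + 1)) a
      (u ∘ (PiLp.continuousLinearEquiv 2 ℝ fun _ : Fin (m + 1) => ℝ).symm)
      (fun z => (fderivWithin ℝ u (closure (upperHalfSpace (m + 1)))
        ((PiLp.continuousLinearEquiv 2 ℝ fun _ : Fin (m + 1) => ℝ).symm z)).comp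
        ((PiLp.continuousLinearEquiv 2 ℝ fun _ : Fin (m + 1) => ℝ).symm :
          (Fin (m + 1) → ℝ) →L[ℝ] EuclideanSpace ℝ (Fin (m + 1)))) := by
  set e := PiLp.continuousLinearEquiv 2 ℝ fun _ : Fin (m + 1) => ℝ with he
  set l := lastIdx (m + 1)
  set H := closure (upperHalfSpace (m + 1)) with hH
  have hmaps : MapsTo e.symm {z | 0 ≤ z l} H := by
    intro z hz
    rw [hH, closure_upperHalfSpace]
    exact hz
  have hopen : IsOpen {z : Fin (m + 1) → ℝ | 0 < z l} :=
    isOpen_lt continuous_const (continuous_apply l)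
  set F : EuclideanSpace ℝ (Fin (m + 1)) → EuclideanSpace ℝ (Fin (m + 1)) :=
    fun y => y l ^ a • gradient u y with hF
  have hFd x (hx : x ∈ upperHalfSpace (m + 1)) : DifferentiableAt ℝ F x := by
    have h1 : ContDiffAt ℝ 2 u x := hu2.contDiffAt ((isOpen_upperHalfSpace _).mem_nhds hx)
    have h2 : DifferentiableAt ℝ (fderiv ℝ u) x :=
      (h1.fderiv_right (m := 1) (by norm_num)).differentiableAt one_ne_zero
    have h3 : DifferentiableAt ℝ (gradient u) x :=
      ((InnerProductSpace.toDual ℝ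
        (EuclideanSpace ℝ (Fin (m + 1)))).symm.differentiable.differentiableAt).comp x h2
    have h4 : DifferentiableAt ℝ (fun y : EuclideanSpace ℝ (Fin (m + 1)) => y l ^ a) x := by
      refine DifferentiableAt.rpow_const (by fun_prop) (Or.inl (ne_of_gt hx))
    exact h4.smul h3
  have hG z (hz : 0 < z l) : HasFDerivAt
      (fun z i => z l ^ a * (fderivWithin ℝ u H (e.symm z)).comp
        (e.symm : (Fin (m + 1) → ℝ) →L[ℝ] EuclideanSpace ℝ (Fin (m + 1))) (Pi.single i 1))
      ((e : EuclideanSpace ℝ (Fin (m + 1)) →L[ℝ] (Fin (m + 1) → ℝ)).comp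
        ((fderiv ℝ F (e.symm z)).comp
          (e.symm : (Fin (m + 1) → ℝ) →L[ℝ] EuclideanSpace ℝ (Fin (m + 1))))) z := by
    have h1 : HasFDerivAt (fun z => e (F (e.symm z))) _ z :=
      e.hasFDerivAt.comp z (((hFd (e.symm z) hz).hasFDerivAt).comp z e.symm.hasFDerivAt)
    refine h1.congr_of_eventuallyEq ?_
    filter_upwards [hopen.mem_nhds hz] with y hy
    ext i
    have hy' : H ∈ 𝓝 (e.symm y) :=
      mem_of_superset ((isOpen_upperHalfSpace (m + 1)).mem_nhds hy) subset_closure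
    have h2 : e (F (e.symm y)) i = y l ^ a * gradient u (e.symm y) i := rfl
    rw [h2, gradient_apply_eq_fderiv, fderivWithin_of_mem_nhds hy']
    rfl
  refine ⟨fun z hz => ?_, ?_, fun z hz => (hG z hz).differentiableAt, fun z hz => ?_⟩
  · exact ((hu1.differentiableOn one_ne_zero _ (hmaps hz)).hasFDerivWithinAt).comp z
      e.symm.hasFDerivAt.hasFDerivWithinAt hmaps
  · exact ((hu1.continuousOn_fderivWithin (uniqueDiffOn_closure_upperHalfSpace _) le_rfl).comp
      e.symm.continuous.continuousOn hmaps).clm_comp continuousOn_const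
  · rw [(hG z hz).fderiv, ← heq (e.symm z) hz, weightedLaplacian, divergence]
    refine Finset.sum_congr rfl fun i _ => ?_
    have h1 : HasFDerivAt (fun y => F y i)
        ((EuclideanSpace.proj i : EuclideanSpace ℝ (Fin (m + 1)) →L[ℝ] ℝ).comp
          (fderiv ℝ F (e.symm z))) (e.symm z) :=
      (EuclideanSpace.proj i : EuclideanSpace ℝ (Fin (m + 1)) →L[ℝ] ℝ).hasFDerivAt.comp _
        (hFd (e.symm z) hz).hasFDerivAt
    change _ = fderiv ℝ (fun y => F y i) (e.symm z) (EuclideanSpace.single i 1)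
    rw [h1.fderiv]
    rfl

theorem corollary1p3 (n : ℕ) [NeZero n] (hn : 2 ≤ n) (a : ℝ) (ha0 : 0 < a) (ha1 : a < 1)
    (u : EuclideanSpace ℝ (Fin n) → ℝ)
    (hu2 : ContDiffOn ℝ 2 u (upperHalfSpace n))
    (hu1 : ContDiffOn ℝ 1 u (closure (upperHalfSpace n)))
    (heq : ∀ x ∈ upperHalfSpace n, weightedLaplacian a u x = 0)
    (hpos : ∀ x ∈ upperHalfSpace n, 0 < u x) :
    ∃ C : ℝ, 0 < C ∧ ∀ x ∈ closure (upperHalfSpace n), u x = C := by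
  obtain ⟨m, rfl⟩ : ∃ m, n = m + 1 := ⟨n - 1, by omega⟩
  have h := isWeightedHarmonic_of_weightedLaplacian_eq_zero hu2 hu1 heq
  -- Positivity survives on the boundary only as nonnegativity; strict positivity of the constant is
  -- read off at an interior point.
  have hnonneg x (hx : x ∈ closure (upperHalfSpace (m + 1))) : 0 ≤ u x :=
    closure_minimal (t := {y | 0 ≤ y}) (by rintro _ ⟨x, hx, rfl⟩; exact (hpos x hx).le)
      isClosed_Ici (hu1.continuousOn.image_closure (mem_image_of_mem u hx))
  have hconst x (hx : x ∈ closure (upperHalfSpace (m + 1))) : u x = u 0 := by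
    rw [closure_upperHalfSpace] at hnonneg hx
    exact h.eq_apply_zero ha0 ha1.le (fun z hz => hnonneg _ hz)
      (z := PiLp.continuousLinearEquiv 2 ℝ (fun _ => ℝ) x) hx
  have hmem : EuclideanSpace.single (lastIdx (m + 1)) (1 : ℝ) ∈ upperHalfSpace (m + 1) := by
    simp [upperHalfSpace]
  exact ⟨u 0, hconst _ (subset_closure hmem) ▸ hpos _ hmem, hconst⟩
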